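/- Let $M$ be a connected smooth manifold (Hausdorff, finite-dimensional) and let $V\to M$ be a smooth real vector bundle of finite rank, with space of smooth sections $\Gamma(V)$. A non-asymmetric Courant algebroid structure on $V$ consists of: a smooth vector bundle morphism $\rho:V\to TM$ (the anchor); an $\mathbb R$-bilinear product $(s,s')\mapsto ss'$ on $\Gamma(V)$; a smooth, fibrewise nondegenerate symmetric bilinear form $\langle\cdot,\cdot\rangle$ on $V$; and an $\mathbb R$-linear map $D:C^\infty(M)\to\Gamma(V)$ with $D(fg)=fD(g)+gD(f)$, such that for all $s,s',s''\in\Gamma(V)$ and $f\in C^\infty(M)$, with $(s,s',s'')=s(s's'')-(ss')s''$, 1. $(s,s',s'')-(s',s,s'')=D\big(\delta\langle\cdot,\cdot\rangle(s,s',s'')\big)$, where $\delta\langle\cdot,\cdot\rangle(s,s',s'')=-\rho(s)\langle s',s''\rangle+\langle ss',s''\rangle+\langle s',ss''\rangle+\rho(s')\langle s,s''\rangle-\langle s's,s''\rangle-\langle s,s's''\rangle$; 2. $(fs)s'=f(ss')$; 3. $\rho(s)\langle s',s''\rangle=\langle ss'+D\langle s,s'\rangle,s''\rangle+\langle s',ss''+D\langle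 s,s''\rangle\rangle$. Assume that the anchor $\rho$ is zero. Then the product on sections is $C^\infty(M)$-bilinear and induces on each fibre $V_x$ a bilinear product by $s(x)\cdot s'(x)=(ss')(x)$; this makes $V_x$ a Koszul–Vinberg algebra, i.e. $a(bc)-(ab)c=b(ac)-(ba)c$ for all $a,b,c\in V_x$. For a Koszul–Vinberg algebra $A$, let $H^2(A,A)=Z^2/B^2$, where $Z^2$ is the space of bilinear maps $\Theta:A\times A\to A$ satisfying $$a\Theta(b,c)-\Theta(ab,c)-\Theta(b,ac)+\Theta(b,a)c=b\Theta(a,c)-\Theta(ba,c)-\Theta(a,bc)+\Theta(a,b)c\qquad(a,b,c\in A),$$ and $B^2$ is the space of bilinear maps of the form $(a,b)\mapsto a\theta(b)-\theta(ab)+\theta(a)b$ with $\theta:A\to A$ linear. Theorem 7.5. If $H^2(V_x,V_x)=0$ for every $x\in M$, then the bundle $(V,\cdot)$ of Koszul–Vinberg algebras is locally trivial: there is a fixed Koszul–Vinberg algebra $(F,\mu_0)$ such that every point of $M$ has an open neighbourhood $U$ and a smooth vector bundle trivialization $V|_U\cong U\times F$ whose restriction to each fibre $V_y$, $y\in U$,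 is an isomorphism of algebras $(V_y,\cdot)\cong(F,\mu_0)$. In particular all fibres are isomorphic to $(F,\mu_0)$. -/

import Mathlib

open Bundle Set
open scoped Manifold ContDiff Topology

set_option maxSynthPendingDepth 3

noncomputable section

/-! ### Koszul–Vinberg algebras and their second cohomology -/

section KoszulVinberg

variable {𝕜 A : Type*} [Field 𝕜] [AddCommGroup A] [Module 𝕜 A]

/-- A bilinear product `μ` is a Koszul–Vinberg product when its associator
`a(bc) - (ab)c` is symmetric in `a` and `b`. -/
def IsKoszulVinberg (μ : A →ₗ[𝕜] A →ₗ[𝕜] A) : Prop :=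
  ∀ a b c : A, μ a (μ b c) - μ (μ a b) c - μ b (μ a c) + μ (μ b a) c = 0

/-- The action `(aΘ)(b, c) = a Θ(b, c) - Θ(ab, c) - Θ(b, ac)` of `a` on a 2-cochain `Θ`. -/
def kvAct (μ : A →ₗ[𝕜] A →ₗ[𝕜] A) (a : A) (Θ : A →ₗ[𝕜] A →ₗ[𝕜] A) (b c : A) : A :=
  μ a (Θ b c) - Θ (μ a b) c - Θ b (μ a c)

/-- The coboundary of a 1-cochain `θ` of the Koszul–Vinberg complex of `(A, μ)` with
coefficients in `A`: `δθ(a, b) = -((aθ)(b) + θ(a) b)`, where `(aθ)(b) = a θ(b) - θ(ab)`. -/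
def kvCoboundary₁ (μ : A →ₗ[𝕜] A →ₗ[𝕜] A) (θ : A →ₗ[𝕜] A) (a b : A) : A :=
  -((μ a (θ b) - θ (μ a b)) + μ (θ a) b)

/-- The coboundary of a 2-cochain `Θ` of the Koszul–Vinberg complex of `(A, μ)` with
coefficients in `A`:
`δΘ(a, b, c) = -((aΘ)(b, c) + Θ(b, a) c) + ((bΘ)(a, c) + Θ(a, b) c)`. -/
def kvCoboundary₂ (μ : A →ₗ[𝕜] A →ₗ[𝕜] A) (Θ : A →ₗ[𝕜] A →ₗ[𝕜] A) (a b c : A) : A :=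
  -(kvAct μ a Θ b c + μ (Θ b a) c) + (kvAct μ b Θ a c + μ (Θ a b) c)

/-- The space of 2-cocycles. -/
def kvZ2 (μ : A →ₗ[𝕜] A →ₗ[𝕜] A) : Submodule 𝕜 (A →ₗ[𝕜] A →ₗ[𝕜] A) where
  carrier := {Θ | ∀ a b c : A, kvCoboundary₂ μ Θ a b c = 0}
  zero_mem' := by intro a b c; simp [kvCoboundary₂, kvAct]
  add_mem' := by
    intro Θ Ψ hΘ hΨ a b c
    have h : kvCoboundary₂ μ (Θ + Ψ) a b c
        = kvCoboundary₂ μ Θ a b c + kvCoboundary₂ μ Ψ a b c := by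
      simp only [kvCoboundary₂, kvAct, LinearMap.add_apply, map_add]; abel
    rw [h, hΘ a b c, hΨ a b c, add_zero]
  smul_mem' := by
    intro r Θ hΘ a b c
    have h : kvCoboundary₂ μ (r • Θ) a b c = r • kvCoboundary₂ μ Θ a b c := by
      simp only [kvCoboundary₂, kvAct, LinearMap.smul_apply, map_smul]; module
    rw [h, hΘ a b c, smul_zero]

/-- The space of 2-coboundaries. -/
def kvB2 (μ : A →ₗ[𝕜] A →ₗ[𝕜] A) : Submodule 𝕜 (A →ₗ[𝕜] A →ₗ[𝕜] A) where
  carrier := {Θ | ∃ θ : A →ₗ[𝕜] A, ∀ a b : A, Θ a b = kvCoboundary₁ μ θ a b}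
  zero_mem' := ⟨0, by simp [kvCoboundary₁]⟩
  add_mem' := by
    rintro Θ Ψ ⟨θ, hθ⟩ ⟨ψ, hψ⟩
    refine ⟨θ + ψ, fun a b => ?_⟩
    simp only [LinearMap.add_apply, hθ, hψ, kvCoboundary₁, map_add]; abel
  smul_mem' := by
    rintro r Θ ⟨θ, hθ⟩
    refine ⟨r • θ, fun a b => ?_⟩
    simp only [LinearMap.smul_apply, hθ, kvCoboundary₁, map_smul]; module

/-- The second Koszul–Vinberg cohomology space `H²(A, A)`: 2-cocycles modulo 2-coboundaries. -/
abbrev KVH2 (μ : A →ₗ[𝕜] A →ₗ[𝕜] A) : Type _ :=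
  kvZ2 μ ⧸ (kvB2 μ).comap (kvZ2 μ).subtype

end KoszulVinberg

/-! ### Non asymmetric Courant algebroids -/

section Algebroid

variable (d : ℕ) {M : Type*} [TopologicalSpace M] [ChartedSpace (EuclideanSpace ℝ (Fin d)) M]
  (F : Type*) [NormedAddCommGroup F] [NormedSpace ℝ F]
  (V : M → Type*) [TopologicalSpace (TotalSpace F V)]
  [∀ x, AddCommGroup (V x)] [∀ x, Module ℝ (V x)] [∀ x, TopologicalSpace (V x)]
  [FiberBundle F V] [VectorBundle ℝ F V]

variable {d F V} in
/-- The product `f s` of a smooth function and a smooth section. -/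
def smulSection (f : C^∞⟮𝓡 d, M; ℝ⟯) (s : Cₛ^∞⟮𝓡 d; F, V⟯) : Cₛ^∞⟮𝓡 d; F, V⟯ where
  toFun := fun x => f x • s x
  contMDiff_toFun := f.contMDiff.smul_section s.contMDiff

/-- The data of an anchored almost algebroid with a fibrewise nondegenerate symmetric bilinear
form on a smooth vector bundle `V`: a smooth bundle map from `V` to the tangent bundle, an
arbitrary real algebra structure on the smooth sections, and a smooth bundle metric. -/
structure MetricAlmostAlgebroid [IsManifold (𝓡 d) ∞ M] where
  anchor : ∀ x : M, V x →ₗ[ℝ] TangentSpace (𝓡 d) x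
  contMDiff_anchor : ContMDiff ((𝓡 d).prod 𝓘(ℝ, F)) (𝓡 d).tangent ∞
    (fun p : TotalSpace F V => (⟨p.proj, anchor p.proj p.snd⟩ : TangentBundle (𝓡 d) M))
  mul : Cₛ^∞⟮𝓡 d; F, V⟯ →ₗ[ℝ] Cₛ^∞⟮𝓡 d; F, V⟯ →ₗ[ℝ] Cₛ^∞⟮𝓡 d; F, V⟯
  form : ∀ x : M, V x →ₗ[ℝ] V x →ₗ[ℝ] ℝ
  contMDiff_form : ∀ s t : Cₛ^∞⟮𝓡 d; F, V⟯,
    ContMDiff (𝓡 d) 𝓘(ℝ, ℝ) ∞ (fun x => form x (s x) (t x))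
  form_symm : ∀ (x : M) (v w : V x), form x v w = form x w v
  form_nondegenerate : ∀ (x : M) (v : V x), (∀ w : V x, form x v w = 0) → v = 0

namespace MetricAlmostAlgebroid

variable {d F V} [IsManifold (𝓡 d) ∞ M] (A : MetricAlmostAlgebroid d F V)

/-- The smooth function `⟨s, t⟩`. -/
def pairing (s t : Cₛ^∞⟮𝓡 d; F, V⟯) : C^∞⟮𝓡 d, M; ℝ⟯ :=
  ⟨fun x => A.form x (s x) (t x), A.contMDiff_form s t⟩

/-- The smooth function `ρ(s) f`, the derivative of `f` along the vector field `ρ(s)`. -/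
def anchorDeriv (s : Cₛ^∞⟮𝓡 d; F, V⟯) (f : C^∞⟮𝓡 d, M; ℝ⟯) : C^∞⟮𝓡 d, M; ℝ⟯ where
  val := fun x => (mfderiv (𝓡 d) 𝓘(ℝ, ℝ) f x (A.anchor x (s x)) : ℝ)
  property := by
    have h1 : ContMDiff (𝓡 d) (𝓡 d).tangent ∞
        (fun x => (⟨x, A.anchor x (s x)⟩ : TangentBundle (𝓡 d) M)) :=
      A.contMDiff_anchor.comp s.contMDiff
    have h2 := (f.contMDiff.contMDiff_tangentMap (m := ∞) (by simp)).comp h1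
    exact (contMDiff_snd_tangentBundle_modelSpace ℝ 𝓘(ℝ, ℝ)).comp h2

theorem pairing_apply (s t : Cₛ^∞⟮𝓡 d; F, V⟯) (x : M) :
    A.pairing s t x = A.form x (s x) (t x) := rfl

theorem anchorDeriv_apply (s : Cₛ^∞⟮𝓡 d; F, V⟯) (f : C^∞⟮𝓡 d, M; ℝ⟯) (x : M) :
    A.anchorDeriv s f x = (mfderiv (𝓡 d) 𝓘(ℝ, ℝ) f x (A.anchor x (s x)) : ℝ) := rfl

/-- The associator `s(tu) - (st)u`. -/
def associator (s t u : Cₛ^∞⟮𝓡 d; F, V⟯) : Cₛ^∞⟮𝓡 d; F, V⟯ :=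
  A.mul s (A.mul t u) - A.mul (A.mul s t) u

/-- The smooth function
`δ⟨·,·⟩(s, t, u) = -ρ(s)⟨t, u⟩ + ⟨st, u⟩ + ⟨t, su⟩ + ρ(t)⟨s, u⟩ - ⟨ts, u⟩ - ⟨s, tu⟩`. -/
def pairingCoboundary (s t u : Cₛ^∞⟮𝓡 d; F, V⟯) : C^∞⟮𝓡 d, M; ℝ⟯ :=
  -A.anchorDeriv s (A.pairing t u) + A.pairing (A.mul s t) u + A.pairing t (A.mul s u)
    + A.anchorDeriv t (A.pairing s u) - A.pairing (A.mul t s) u - A.pairing s (A.mul t u)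

end MetricAlmostAlgebroid

/-- A non asymmetric Courant algebroid. The operator `D` is a 1-cocycle of the Koszul–Vinberg
complex of the algebra of smooth functions with values in the sections of `V`, which means
`δD(f, g) = -(f D(g) - D(fg) + g D(f)) = 0`. -/
structure NonAsymmetricCourantAlgebroid [IsManifold (𝓡 d) ∞ M] extends
    MetricAlmostAlgebroid d F V where
  D : C^∞⟮𝓡 d, M; ℝ⟯ →ₗ[ℝ] Cₛ^∞⟮𝓡 d; F, V⟯
  D_cocycle : ∀ f g : C^∞⟮𝓡 d, M; ℝ⟯, smulSection f (D g) - D (f * g) + smulSection g (D f) = 0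
  associator_sub : ∀ s t u : Cₛ^∞⟮𝓡 d; F, V⟯,
    toMetricAlmostAlgebroid.associator s t u - toMetricAlmostAlgebroid.associator t s u
      = D (toMetricAlmostAlgebroid.pairingCoboundary s t u)
  smul_mul : ∀ (f : C^∞⟮𝓡 d, M; ℝ⟯) (s t : Cₛ^∞⟮𝓡 d; F, V⟯),
    mul (smulSection f s) t = smulSection f (mul s t)
  anchorDeriv_pairing : ∀ s t u : Cₛ^∞⟮𝓡 d; F, V⟯,
    toMetricAlmostAlgebroid.anchorDeriv s (toMetricAlmostAlgebroid.pairing t u)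
      = toMetricAlmostAlgebroid.pairing
          (mul s t + D (toMetricAlmostAlgebroid.pairing s t)) u
        + toMetricAlmostAlgebroid.pairing t
          (mul s u + D (toMetricAlmostAlgebroid.pairing s u))

section Tensoriality

variable {d F V}

theorem smulSection_apply (f : C^∞⟮𝓡 d, M; ℝ⟯) (s : Cₛ^∞⟮𝓡 d; F, V⟯) (x : M) :
    smulSection f s x = f x • s x := rfl

theorem sum_section_apply {ι : Type*} (t : Finset ι) (s : ι → Cₛ^∞⟮𝓡 d; F, V⟯) (x : M) :
    (∑ i ∈ t, s i) x = ∑ i ∈ t, s i x := by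
  have h := map_sum (ContMDiffSection.coeAddHom (𝓡 d) F ∞ V) s t
  have h' := congrFun h x
  rw [Finset.sum_apply] at h'
  exact h'

variable [IsManifold (𝓡 d) ∞ M] [T2Space M]

theorem exists_smooth_cutoff (x : M) {u : Set M} (hu : u ∈ 𝓝 x) :
    ∃ ψ : C^∞⟮𝓡 d, M; ℝ⟯, ψ x = 1 ∧ tsupport ψ ⊆ u := by
  obtain ⟨φ, -, hφ⟩ := (SmoothBumpFunction.nhds_basis_tsupport (I := 𝓡 d) x).mem_iff.1 hu
  exact ⟨⟨φ, φ.contMDiff⟩, φ.eq_one, hφ⟩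

variable [FiniteDimensional ℝ F] [ContMDiffVectorBundle ∞ F V (𝓡 d)]

/-- Every vector in a fibre is the value of a global smooth section. -/
theorem exists_section_eq (x : M) (v : V x) : ∃ s : Cₛ^∞⟮𝓡 d; F, V⟯, s x = v := by
  set t := trivializationAt F V x
  have hx : x ∈ t.baseSet := FiberBundle.mem_baseSet_trivializationAt' x
  obtain ⟨ψ, hψx, hψ⟩ := exists_smooth_cutoff (d := d) x (t.open_baseSet.mem_nhds hx)
  let b := Module.finBasis ℝ F
  let c := (t.basisAt b hx).repr v
  let σ : Π y : M, V y := fun y => ∑ i, c i • t.localFrame b i y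
  have hσ : ContMDiffOn (𝓡 d) ((𝓡 d).prod 𝓘(ℝ, F)) ∞
      (fun y => TotalSpace.mk' F y (σ y)) t.baseSet :=
    ContMDiffOn.sum_section fun i _ =>
      ContMDiffOn.const_smul_section (t.contMDiffOn_localFrame_baseSet ∞ b i)
  refine ⟨⟨_, ContMDiffOn.smul_section_of_tsupport ψ.contMDiff.contMDiffOn t.open_baseSet hψ hσ⟩,
    ?_⟩
  change ψ x • σ x = v
  rw [hψx, one_smul]
  simp only [σ, c, t.localFrame_apply_of_mem_baseSet b hx]
  exact (t.basisAt b hx).sum_repr v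

/-- An additive map on smooth sections that is linear over the smooth functions is determined at
`x` by the value of the section at `x`. -/
theorem apply_eq_zero_of_apply_eq_zero (T : Cₛ^∞⟮𝓡 d; F, V⟯ →ₗ[ℝ] Cₛ^∞⟮𝓡 d; F, V⟯)
    (hT : ∀ (f : C^∞⟮𝓡 d, M; ℝ⟯) (s : Cₛ^∞⟮𝓡 d; F, V⟯),
      T (smulSection f s) = smulSection f (T s))
    (x : M) (s : Cₛ^∞⟮𝓡 d; F, V⟯) (hs : s x = 0) : T s x = 0 := by
  have : ContMDiffVectorBundle 1 F V (𝓡 d) := ContMDiffVectorBundle.of_le (n := ∞) (by simp)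
  set t := trivializationAt F V x
  have hx : x ∈ t.baseSet := FiberBundle.mem_baseSet_trivializationAt' x
  obtain ⟨ψ, hψx, hψ⟩ := exists_smooth_cutoff (d := d) x (t.open_baseSet.mem_nhds hx)
  let b := Module.finBasis ℝ F
  let e : Fin (Module.finrank ℝ F) → Cₛ^∞⟮𝓡 d; F, V⟯ := fun i =>
    ⟨_, ContMDiffOn.smul_section_of_tsupport ψ.contMDiff.contMDiffOn t.open_baseSet hψ
      (t.contMDiffOn_localFrame_baseSet ∞ b i)⟩
  let f : Fin (Module.finrank ℝ F) → C^∞⟮𝓡 d, M; ℝ⟯ := fun i =>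
    ⟨fun y => ψ y • t.localFrameCoeff (𝓡 d) b i y (s y), by
      refine contMDiff_of_tsupport fun y hy => ?_
      have hy' : y ∈ t.baseSet := hψ (tsupport_smul_subset_left _ _ hy)
      exact ψ.contMDiff.contMDiffAt.smul
        (contMDiffAt_localFrameCoeff b hy' s.contMDiff.contMDiffAt i)⟩
  have hdec : smulSection ψ (smulSection ψ s) = ∑ i, smulSection (f i) (e i) := by
    ext y
    rw [sum_section_apply]
    change ψ y • ψ y • s y = ∑ i, (ψ y • t.localFrameCoeff (𝓡 d) b i y (s y)) •
      (ψ y • t.localFrame b i y)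
    by_cases hy : y ∈ t.baseSet
    · conv_lhs => rw [t.eq_sum_localFrameCoeff_smul (I := 𝓡 d) (b := b) (s := s) hy]
      simp only [Finset.smul_sum, smul_smul, smul_eq_mul]
      refine Finset.sum_congr rfl fun i _ => ?_
      congr 1
      ring
    · have : ψ y = 0 := image_eq_zero_of_notMem_tsupport fun h => hy (hψ h)
      simp [this]
  have h1 : T s x = T (smulSection ψ (smulSection ψ s)) x := by
    rw [hT, hT, smulSection_apply, smulSection_apply, hψx, one_smul, one_smul]
  rw [h1, hdec, map_sum, sum_section_apply]
  refine Finset.sum_eq_zero fun i _ => ?_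
  have hf : f i x = 0 := by
    change ψ x • t.localFrameCoeff (𝓡 d) b i x (s x) = 0
    rw [hs, map_zero, smul_zero]
  rw [hT, smulSection_apply, hf, zero_smul]

end Tensoriality

namespace NonAsymmetricCourantAlgebroid

variable {d F V} [IsManifold (𝓡 d) ∞ M] [T2Space M] [FiniteDimensional ℝ F]
  [ContMDiffVectorBundle ∞ F V (𝓡 d)] (A : NonAsymmetricCourantAlgebroid d F V)

theorem D_eq_zero (f : C^∞⟮𝓡 d, M; ℝ⟯) : A.D f = 0 := by
  have key : ∀ (s t u : Cₛ^∞⟮𝓡 d; F, V⟯) (x : M),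
      A.form x (s x) (t x) * A.form x (A.D f x) (u x)
        + A.form x (s x) (u x) * A.form x (t x) (A.D f x) = 0 := by
    intro s t u x
    have h1 := congrArg (fun g : C^∞⟮𝓡 d, M; ℝ⟯ => g x) (A.anchorDeriv_pairing s t u)
    have h2 := congrArg (fun g : C^∞⟮𝓡 d, M; ℝ⟯ => g x)
      (A.anchorDeriv_pairing (smulSection f s) t u)
    have e1 : ∀ w : Cₛ^∞⟮𝓡 d; F, V⟯, A.pairing (smulSection f s) w = f * A.pairing s w := by
      intro w; ext y
      rw [ContMDiffMap.coe_mul, Pi.mul_apply, A.pairing_apply, A.pairing_apply, smulSection_apply,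
        map_smul, LinearMap.smul_apply, smul_eq_mul]
    have e2 : ∀ g : C^∞⟮𝓡 d, M; ℝ⟯, A.D (f * g) = smulSection f (A.D g) + smulSection g (A.D f) := by
      intro g
      have := A.D_cocycle f g
      rw [sub_add_eq_add_sub, sub_eq_zero] at this
      exact this.symm
    have e3 : ∀ g : C^∞⟮𝓡 d, M; ℝ⟯,
        A.anchorDeriv (smulSection f s) g x = f x * A.anchorDeriv s g x := by
      intro g
      rw [A.anchorDeriv_apply, A.anchorDeriv_apply, smulSection_apply, map_smul]
      exact map_smul (mfderiv (𝓡 d) 𝓘(ℝ, ℝ) g x) (f x) (A.anchor x (s x))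
    simp only [e1, e2, e3, A.smul_mul] at h2
    rw [h1] at h2
    simp only [ContMDiffMap.coe_add, Pi.add_apply, A.pairing_apply, smulSection_apply,
      ContMDiffSection.coe_add, map_add, map_smul, LinearMap.add_apply, LinearMap.smul_apply,
      smul_eq_mul] at h2
    linarith
  ext x
  refine A.form_nondegenerate x _ fun w => ?_
  obtain ⟨t, rfl⟩ := exists_section_eq (d := d) (F := F) x w
  by_contra hne
  have hv : t x ≠ 0 := fun h => hne (by rw [h, map_zero])
  obtain ⟨v, hv⟩ : ∃ v, A.form x (t x) v ≠ 0 := by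
    by_contra! h
    exact hv (A.form_nondegenerate x _ h)
  obtain ⟨s, rfl⟩ := exists_section_eq (d := d) (F := F) x v
  have h := key s t t x
  rw [A.form_symm x (s x), A.form_symm x (t x) (A.D f x), ← two_mul] at h
  exact mul_ne_zero two_ne_zero (mul_ne_zero hv hne) h

/-- When the anchor vanishes, the product of sections induces a product on every fibre. -/
theorem exists_fibreMul (hρ : A.anchor = 0) (x : M) :
    ∃ μ : V x →ₗ[ℝ] V x →ₗ[ℝ] V x, ∀ s t : Cₛ^∞⟮𝓡 d; F, V⟯, A.mul s t x = μ (s x) (t x) := by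
  have hskew : ∀ s t u : Cₛ^∞⟮𝓡 d; F, V⟯,
      A.form x (A.mul s t x) (u x) + A.form x (t x) (A.mul s u x) = 0 := by
    intro s t u
    have h := congrArg (fun g : C^∞⟮𝓡 d, M; ℝ⟯ => g x) (A.anchorDeriv_pairing s t u)
    simp only [A.D_eq_zero, add_zero, ContMDiffMap.coe_add, Pi.add_apply, A.pairing_apply] at h
    rw [← h, A.anchorDeriv_apply, hρ]
    exact map_zero (mfderiv (𝓡 d) 𝓘(ℝ, ℝ) (A.pairing t u) x)
  have hright : ∀ s t : Cₛ^∞⟮𝓡 d; F, V⟯, t x = 0 → A.mul s t x = 0 := by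
    intro s t ht
    refine A.form_nondegenerate x _ fun w => ?_
    obtain ⟨u, rfl⟩ := exists_section_eq (d := d) (F := F) x w
    have h := hskew s t u
    rwa [ht, map_zero, LinearMap.zero_apply, add_zero] at h
  have hleft : ∀ s t : Cₛ^∞⟮𝓡 d; F, V⟯, s x = 0 → A.mul s t x = 0 := fun s t hs =>
    apply_eq_zero_of_apply_eq_zero (A.mul.flip t) (fun f s => A.smul_mul f s t) x s hs
  choose σ hσ using fun v : V x => exists_section_eq (d := d) (F := F) x v
  have hwell : ∀ s s' t t' : Cₛ^∞⟮𝓡 d; F, V⟯, s x = s' x → t x = t' x →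
      A.mul s t x = A.mul s' t' x := by
    intro s s' t t' hs ht
    have h1 : A.mul (s - s') t x = 0 := hleft _ _ (by simp [hs])
    have h2 : A.mul s' (t - t') x = 0 := hright _ _ (by simp [ht])
    simp only [map_sub, LinearMap.sub_apply, ContMDiffSection.coe_sub, Pi.sub_apply,
      sub_eq_zero] at h1 h2
    exact h1.trans h2
  refine ⟨LinearMap.mk₂ ℝ (fun v w => A.mul (σ v) (σ w) x) ?_ ?_ ?_ ?_,
    fun s t => hwell _ _ _ _ (hσ _).symm (hσ _).symm⟩
  · intro v v' w
    rw [hwell (σ (v + v')) (σ v + σ v') (σ w) (σ w) (by simp [hσ]) rfl]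
    simp
  · intro c v w
    rw [hwell (σ (c • v)) (c • σ v) (σ w) (σ w) (by simp [hσ]) rfl]
    simp
  · intro v w w'
    rw [hwell (σ v) (σ v) (σ (w + w')) (σ w + σ w') rfl (by simp [hσ])]
    simp
  · intro c v w
    rw [hwell (σ v) (σ v) (σ (c • w)) (c • σ w) rfl (by simp [hσ])]
    simp

/-- The product of the fibre `V x` of a non asymmetric Courant algebroid with vanishing anchor:
the unique bilinear product with `s(x) · t(x) = (s · t)(x)` for all smooth sections. -/
def fibreMul (hρ : A.anchor = 0) (x : M) : V x →ₗ[ℝ] V x →ₗ[ℝ] V x :=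
  (A.exists_fibreMul hρ x).choose

theorem mul_apply (hρ : A.anchor = 0) (s t : Cₛ^∞⟮𝓡 d; F, V⟯) (x : M) :
    A.mul s t x = A.fibreMul hρ x (s x) (t x) :=
  (A.exists_fibreMul hρ x).choose_spec s t

end NonAsymmetricCourantAlgebroid

/-- A family `μ` of bilinear products on the fibres of a smooth vector bundle is a locally trivial
bundle of Koszul–Vinberg algebras: there is one Koszul–Vinberg algebra `(F, μ₀)` such that near
every point the bundle has a smooth local trivialization with fibre `F` which is an isomorphism of
algebras onto `(F, μ₀)` on each fibre. -/
def IsLocallyTrivialKVBundle (μ : ∀ x : M, V x →ₗ[ℝ] V x →ₗ[ℝ] V x) : Prop :=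
  ∃ μ₀ : F →ₗ[ℝ] F →ₗ[ℝ] F, IsKoszulVinberg μ₀ ∧
    ∀ x : M, ∃ e : Trivialization F (π F V), x ∈ e.baseSet ∧ e.IsLinear ℝ ∧
      ContMDiffOn ((𝓡 d).prod 𝓘(ℝ, F)) ((𝓡 d).prod 𝓘(ℝ, F)) ∞ e e.source ∧
      ContMDiffOn ((𝓡 d).prod 𝓘(ℝ, F)) ((𝓡 d).prod 𝓘(ℝ, F)) ∞
        e.toOpenPartialHomeomorph.symm e.target ∧
      ∀ y ∈ e.baseSet, ∀ v w : V y,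
        (e (TotalSpace.mk' F y (μ y v w))).2
          = μ₀ (e (TotalSpace.mk' F y v)).2 (e (TotalSpace.mk' F y w)).2

end Algebroid

end

/-!
The statement is the rigidity of algebras with vanishing second cohomology, with smooth dependence
on parameters.

Since the anchor and `D` vanish, each fibre product is a Koszul–Vinberg product
(`isKoszulVinberg_fibreMul`), and in a local trivialization these products form a smooth family
`y ↦ ν y` of bilinear maps on `F` (`contMDiffAt_trivializedMul`). The derivative at `1` of the
pullback action `g ↦ g⁻¹ μ(g ·, g ·)` of `GL(F)` is, up to sign, the coboundary of 1-cochains, and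
the linearization at `μ` of the Koszul–Vinberg identity is, up to sign, the coboundary of
2-cochains. Let `C` be a complement of the image of the former. By the inverse function theorem
every bilinear map near `μ` is the pullback of some `μ + c` with `c ∈ C` small, by an element `g`
depending smoothly on it. If it is a Koszul–Vinberg product then so is `μ + c`. When `H² = 0` the
linearized identity is injective on `C`, hence `c = 0`
(`eventually_eq_zero_of_quadratic_eq_zero`). So every Koszul–Vinberg product near `μ` is isomorphic
to `μ`, through an isomorphism depending smoothly on it (`exists_contDiffAt_isomorphism`).

Applied to the family `ν` near a point, this gives isomorphisms of the nearby fibres with the fibre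
at that point, varying smoothly. Isomorphism of fibres is thus an equivalence relation with open
classes, and over a connected base there is only one class (`exists_linearEquiv_fibre`). Composing
a bundle trivialization with the smooth family of isomorphisms and with one isomorphism onto the
model algebra gives the required trivialization (`exists_trivialization_comp`).
-/

noncomputable section

/-! ### Cohomology and isomorphisms of Koszul–Vinberg algebras -/

section Transport

variable {𝕜 A A' : Type*} [Field 𝕜] [AddCommGroup A] [Module 𝕜 A] [AddCommGroup A'] [Module 𝕜 A']

theorem kvZ2_le_kvB2_of_subsingleton {μ : A →ₗ[𝕜] A →ₗ[𝕜] A} (h : Subsingleton (KVH2 μ)) :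
    kvZ2 μ ≤ kvB2 μ := by
  rw [Submodule.Quotient.subsingleton_iff] at h
  intro Θ hΘ
  have : (⟨Θ, hΘ⟩ : kvZ2 μ) ∈ (kvB2 μ).comap (kvZ2 μ).subtype := h ▸ Submodule.mem_top
  exact this

variable {μ : A →ₗ[𝕜] A →ₗ[𝕜] A} {μ' : A' →ₗ[𝕜] A' →ₗ[𝕜] A'} (L : A ≃ₗ[𝕜] A')

theorem IsKoszulVinberg.of_linearEquiv (hL : ∀ a b, L (μ a b) = μ' (L a) (L b))
    (h : IsKoszulVinberg μ) : IsKoszulVinberg μ' := by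
  intro a b c
  obtain ⟨a, rfl⟩ := L.surjective a
  obtain ⟨b, rfl⟩ := L.surjective b
  obtain ⟨c, rfl⟩ := L.surjective c
  simp only [← hL, ← map_sub, ← map_add, h a b c, map_zero]

theorem kvZ2_le_kvB2_of_linearEquiv (hL : ∀ a b, L (μ a b) = μ' (L a) (L b))
    (h : kvZ2 μ ≤ kvB2 μ) : kvZ2 μ' ≤ kvB2 μ' := by
  intro Θ hΘ
  have hL' : ∀ a b, L.symm (μ' a b) = μ (L.symm a) (L.symm b) := by
    intro a b
    rw [LinearEquiv.symm_apply_eq, hL, L.apply_symm_apply, L.apply_symm_apply]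
  have hmem : (Θ.compl₁₂ L.toLinearMap L.toLinearMap).compr₂ L.symm.toLinearMap ∈ kvZ2 μ := by
    intro a b c
    have h3 := congrArg L.symm (hΘ (L a) (L b) (L c))
    simpa only [kvCoboundary₂, kvAct, map_add, map_sub, map_neg, hL', map_zero,
      LinearMap.compr₂_apply, LinearMap.compl₁₂_apply, LinearEquiv.coe_coe,
      L.symm_apply_apply, hL] using h3
  obtain ⟨θ, hθ⟩ := h hmem
  refine ⟨L.toLinearMap ∘ₗ θ ∘ₗ L.symm.toLinearMap, fun a b => ?_⟩
  have h3 := congrArg L (hθ (L.symm a) (L.symm b))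
  simpa only [kvCoboundary₁, map_add, map_sub, map_neg, hL, hL', LinearMap.compr₂_apply,
    LinearMap.compl₁₂_apply, LinearEquiv.coe_coe, L.apply_symm_apply, LinearMap.comp_apply] using h3

end Transport

/-! ### Isolated zeros of quadratic maps along a slice -/

section Quadratic

open Filter

variable {E T : Type*} [NormedAddCommGroup E] [NormedSpace ℝ E] [FiniteDimensional ℝ E]
  [NormedAddCommGroup T] [NormedSpace ℝ T] [FiniteDimensional ℝ T]

theorem LinearMap.exists_comp_eq_of_ker_le_ker {𝕜 E E' T : Type*} [Field 𝕜] [AddCommGroup E]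
    [Module 𝕜 E] [AddCommGroup E'] [Module 𝕜 E'] [AddCommGroup T] [Module 𝕜 T]
    (δ : E →ₗ[𝕜] T) (f : E →ₗ[𝕜] E') (h : LinearMap.ker δ ≤ LinearMap.ker f) :
    ∃ Λ : T →ₗ[𝕜] E', Λ ∘ₗ δ = f := by
  obtain ⟨Λ, hΛ⟩ := LinearMap.exists_extend
    (((LinearMap.ker δ).liftQ f h) ∘ₗ δ.quotKerEquivRange.symm.toLinearMap)
  refine ⟨Λ, LinearMap.ext fun x => ?_⟩
  have h1 := LinearMap.congr_fun hΛ (δ.quotKerEquivRange (Submodule.Quotient.mk x))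
  simpa using h1

/-- Let `P` fix the kernel of the linearization at `μ` of the quadratic map `ν ↦ β ν ν`. On the
affine slice `μ + ker P` the linearization is injective, so `μ` is an isolated zero there. -/
theorem eventually_eq_zero_of_quadratic_eq_zero (β : E →L[ℝ] E →L[ℝ] T) {μ : E}
    (hμ : β μ μ = 0) (P : E →L[ℝ] E) (hP : ∀ w, β μ w + β w μ = 0 → P w = w) :
    ∀ᶠ c in 𝓝 (0 : E), P c = 0 → β (μ + c) (μ + c) = 0 → c = 0 := by
  -- `1 - P` vanishes on the kernel of the linearization, hence factors through it as `Λ`; then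
  -- `R c = Λ (β (μ + c) (μ + c)) + P c` has derivative `1` at `0` and is injective near `0`
  obtain ⟨Λ, hΛ⟩ := LinearMap.exists_comp_eq_of_ker_le_ker (β μ + β.flip μ).toLinearMap
    (ContinuousLinearMap.id ℝ E - P).toLinearMap (by
      intro w hw
      have h1 : β μ w + β w μ = 0 := hw
      simp [hP w h1])
  let ΛL := LinearMap.toContinuousLinearMap Λ
  let R : E → E := fun c => ΛL (β (μ + c) (μ + c)) + P c
  have hR : HasStrictFDerivAt R (ContinuousLinearEquiv.refl ℝ E : E →L[ℝ] E) 0 := by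
    have h0 : HasStrictFDerivAt (fun c : E => μ + c) (ContinuousLinearMap.id ℝ E) 0 :=
      (hasStrictFDerivAt_id _).const_add μ
    have h1 := (ΛL.hasStrictFDerivAt.comp (0 : E)
      ((β.hasStrictFDerivAt.comp (0 : E) h0).clm_apply h0)).add (P.hasStrictFDerivAt (x := 0))
    refine h1.congr_fderiv (ContinuousLinearMap.ext fun c => ?_)
    have h2 : Λ (β μ c + β c μ) = c - P c := LinearMap.congr_fun hΛ c
    simpa [ΛL, eq_sub_iff_add_eq] using h2
  filter_upwards [hR.eventually_left_inverse] with c hc hPc hc0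
  have hR0 : R c = R 0 := by
    simp only [R, hPc, hc0, add_zero, hμ, map_zero]
  rw [← hc, hR0, hR.localInverse_apply_image]

end Quadratic

/-! ### Rigidity of Koszul–Vinberg products with vanishing second cohomology -/

section Rigidity

open ContinuousLinearMap Filter

variable {F : Type*} [NormedAddCommGroup F] [NormedSpace ℝ F]

/-- The polarized Koszul–Vinberg identity
`(a, b, c) ↦ μ(a, ν(b, c)) - μ(ν(a, b), c) - μ(b, ν(a, c)) + μ(ν(b, a), c)`; its value at
`(μ, μ)` is the defect of `μ` from being a Koszul–Vinberg product. -/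
def kvPolar (μ ν : F →L[ℝ] F →L[ℝ] F) : F →L[ℝ] F →L[ℝ] F →L[ℝ] F :=
  ((compL ℝ F F F).bilinearComp μ ν - (compL ℝ F F (F →L[ℝ] F) μ).comp ν)
    - ((compL ℝ F F F).bilinearComp μ ν - (compL ℝ F F (F →L[ℝ] F) μ).comp ν).flip

theorem kvPolar_apply (μ ν : F →L[ℝ] F →L[ℝ] F) (a b c : F) :
    kvPolar μ ν a b c = (μ a (ν b c) - μ (ν a b) c) - (μ b (ν a c) - μ (ν b a) c) := rfl

theorem kvPolar_self_eq_zero {μ : F →L[ℝ] F →L[ℝ] F} (h : IsKoszulVinberg μ.toLinearMap₁₂) :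
    kvPolar μ μ = 0 := by
  ext a b c
  have := h a b c
  simp only [toLinearMap₁₂_apply_apply_apply] at this
  rw [kvPolar_apply]
  simp only [zero_apply]
  rw [← this]
  abel

theorem kvPolar_add_eq_neg_kvCoboundary₂ (μ Θ : F →L[ℝ] F →L[ℝ] F) (a b c : F) :
    (kvPolar μ Θ + kvPolar Θ μ) a b c = -kvCoboundary₂ μ.toLinearMap₁₂ Θ.toLinearMap₁₂ a b c := by
  simp only [add_apply, kvPolar_apply, kvCoboundary₂, kvAct, toLinearMap₁₂_apply_apply_apply]
  abel

/-- The product `(a, b) ↦ h (ν (g a) (g b))`. -/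
def conjBilin (h g : F →L[ℝ] F) (ν : F →L[ℝ] F →L[ℝ] F) : F →L[ℝ] F →L[ℝ] F :=
  (compL ℝ F F F h).comp (((compL ℝ F F F).flip g).comp (ν.comp g))

theorem conjBilin_apply (h g : F →L[ℝ] F) (ν : F →L[ℝ] F →L[ℝ] F) (a b : F) :
    conjBilin h g ν a b = h (ν (g a) (g b)) := rfl

theorem IsKoszulVinberg.of_isUnit {μ ν : F →L[ℝ] F →L[ℝ] F} {g : F →L[ℝ] F} (hg : IsUnit g)
    (h : ∀ a b, g (ν a b) = μ (g a) (g b)) (hν : IsKoszulVinberg ν.toLinearMap₁₂) :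
    IsKoszulVinberg μ.toLinearMap₁₂ := by
  obtain ⟨u, rfl⟩ := hg
  exact hν.of_linearEquiv (ContinuousLinearEquiv.unitsEquiv ℝ F u).toLinearEquiv h

variable [FiniteDimensional ℝ F]

theorem exists_continuousBilinearMap_eq_kvPolar :
    ∃ β : (F →L[ℝ] F →L[ℝ] F) →L[ℝ] (F →L[ℝ] F →L[ℝ] F) →L[ℝ] (F →L[ℝ] F →L[ℝ] F →L[ℝ] F),
      ∀ μ ν, β μ ν = kvPolar μ ν :=
  ⟨(LinearMap.mk₂ ℝ kvPolar
    (by intros; ext a b c; simp [kvPolar_apply]; abel)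
    (by intros; ext a b c; simp [kvPolar_apply]; module)
    (by intros; ext a b c; simp [kvPolar_apply]; abel)
    (by intros; ext a b c; simp [kvPolar_apply]; module)).toContinuousBilinearMap,
    fun _ _ => rfl⟩

/-- Every linear map between vector spaces has a generalized inverse. -/
theorem LinearMap.exists_comp_comp_self_eq {𝕜 E E' : Type*} [Field 𝕜] [AddCommGroup E]
    [Module 𝕜 E] [AddCommGroup E'] [Module 𝕜 E'] (f : E →ₗ[𝕜] E') :
    ∃ g : E' →ₗ[𝕜] E, ∀ x, f (g (f x)) = f x := by
  obtain ⟨g₀, hg₀⟩ := f.rangeRestrict.exists_rightInverse_of_surjective f.range_rangeRestrict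
  obtain ⟨g, hg⟩ := LinearMap.exists_extend g₀
  refine ⟨g, fun x => ?_⟩
  have h1 : g (f x) = g₀ (f.rangeRestrict x) := LinearMap.congr_fun hg (f.rangeRestrict x)
  have h2 := congrArg Subtype.val (LinearMap.congr_fun hg₀ (f.rangeRestrict x))
  rw [h1]
  exact h2

/-- The map `θ ↦ ((a, b) ↦ μ(θ a, b) + μ(a, θ b) - θ(μ(a, b)))`, the opposite of the coboundary of
1-cochains; it is also the derivative at `g = 1` of `g ↦ g⁻¹ μ(g ·, g ·)`. -/
def kvInfinitesimal (μ : F →L[ℝ] F →L[ℝ] F) : (F →L[ℝ] F) →L[ℝ] (F →L[ℝ] F →L[ℝ] F) :=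
  LinearMap.toContinuousLinearMap
    { toFun := fun θ => μ.comp θ + (((compL ℝ F F F).flip θ).comp μ - (compL ℝ F F F θ).comp μ)
      map_add' := by intros; ext a b; simp; abel
      map_smul' := by intros; ext a b; simp; module }

theorem kvInfinitesimal_apply (μ : F →L[ℝ] F →L[ℝ] F) (θ : F →L[ℝ] F) (a b : F) :
    kvInfinitesimal μ θ a b = μ (θ a) b + (μ a (θ b) - θ (μ a b)) := rfl

theorem hasFDerivAt_conjBilin (μ : F →L[ℝ] F →L[ℝ] F)
    (θ : (F →L[ℝ] F →L[ℝ] F) →L[ℝ] (F →L[ℝ] F))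
    (C : (F →L[ℝ] F →L[ℝ] F) →L[ℝ] (F →L[ℝ] F →L[ℝ] F)) :
    HasFDerivAt (fun w => conjBilin (Ring.inverse (1 + θ w)) (1 + θ w) (μ + C w))
      ((kvInfinitesimal μ).comp θ + C) 0 := by
  have hg : HasFDerivAt (fun w => 1 + θ w) θ 0 := θ.hasFDerivAt.const_add 1
  have hν : HasFDerivAt (fun w => μ + C w) C 0 := C.hasFDerivAt.const_add μ
  have hu : 1 + θ 0 = ((1 : (F →L[ℝ] F)ˣ) : F →L[ℝ] F) := by simp
  have hi : HasFDerivAt (fun w => Ring.inverse (1 + θ w)) (-θ) 0 := by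
    have h1 : HasFDerivAt (Ring.inverse : (F →L[ℝ] F) → (F →L[ℝ] F)) _ (1 + θ 0) :=
      hu ▸ hasFDerivAt_ringInverse (𝕜 := ℝ) (1 : (F →L[ℝ] F)ˣ)
    refine (h1.comp 0 hg).congr_fderiv ?_
    ext w a
    simp
  have h1 := ((compL ℝ F F F).hasFDerivAt.comp (0 : F →L[ℝ] F →L[ℝ] F) hi).clm_comp
    (((compL ℝ F F F).flip.hasFDerivAt.comp (0 : F →L[ℝ] F →L[ℝ] F) hg).clm_comp
      (hν.clm_comp hg))
  refine h1.congr_fderiv ?_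
  ext w a b
  simp [kvInfinitesimal_apply]
  abel

theorem contDiffAt_conjBilin (μ : F →L[ℝ] F →L[ℝ] F)
    (θ : (F →L[ℝ] F →L[ℝ] F) →L[ℝ] (F →L[ℝ] F))
    (C : (F →L[ℝ] F →L[ℝ] F) →L[ℝ] (F →L[ℝ] F →L[ℝ] F)) :
    ContDiffAt ℝ ω (fun w => conjBilin (Ring.inverse (1 + θ w)) (1 + θ w) (μ + C w)) 0 := by
  have hg : ContDiffAt ℝ ω (fun w => 1 + θ w) 0 := contDiffAt_const.add θ.contDiff.contDiffAt
  have hν : ContDiffAt ℝ ω (fun w => μ + C w) 0 := contDiffAt_const.add C.contDiff.contDiffAt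
  have hu : 1 + θ 0 = ((1 : (F →L[ℝ] F)ˣ) : F →L[ℝ] F) := by simp
  have hi : ContDiffAt ℝ ω (fun w => Ring.inverse (1 + θ w)) 0 := by
    have h1 : ContDiffAt ℝ ω (Ring.inverse : (F →L[ℝ] F) → (F →L[ℝ] F)) (1 + θ 0) :=
      hu ▸ contDiffAt_ringInverse ℝ (1 : (F →L[ℝ] F)ˣ)
    exact h1.comp 0 hg
  exact ((compL ℝ F F F).contDiff.contDiffAt.comp (0 : F →L[ℝ] F →L[ℝ] F) hi).clm_comp
    (((compL ℝ F F F).flip.contDiff.contDiffAt.comp (0 : F →L[ℝ] F →L[ℝ] F) hg).clm_comp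
      (hν.clm_comp hg))

/-- Rigidity: if every 2-cocycle of `μ` is a 2-coboundary, then every Koszul–Vinberg product `ν`
near `μ` is isomorphic to `μ`, through an isomorphism which depends smoothly on `ν`. Analyticity
(`ω`) is used because, unlike `C^∞` at a point, it passes to a neighbourhood of the point. -/
theorem exists_contDiffAt_isomorphism {μ : F →L[ℝ] F →L[ℝ] F}
    (hμ : IsKoszulVinberg μ.toLinearMap₁₂) (hH : kvZ2 μ.toLinearMap₁₂ ≤ kvB2 μ.toLinearMap₁₂) :
    ∃ g : (F →L[ℝ] F →L[ℝ] F) → (F →L[ℝ] F),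
      ∀ᶠ ν in 𝓝 μ, ContDiffAt ℝ ω g ν ∧ IsUnit (g ν) ∧
        (IsKoszulVinberg ν.toLinearMap₁₂ → ∀ a b, g ν (ν a b) = μ (g ν a) (g ν b)) := by
  obtain ⟨β, hβ⟩ := exists_continuousBilinearMap_eq_kvPolar (F := F)
  -- a linear choice `θ` of primitives of the coboundaries
  obtain ⟨θ₀, hθ₀⟩ := LinearMap.exists_comp_comp_self_eq (kvInfinitesimal μ).toLinearMap
  let θ := LinearMap.toContinuousLinearMap θ₀
  let P := (kvInfinitesimal μ).comp θ
  have hPd : ∀ φ, P (kvInfinitesimal μ φ) = kvInfinitesimal μ φ := hθ₀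
  have hPP : ∀ w, P (P w) = P w := fun w => hPd (θ w)
  have hP : ∀ Θ, β μ Θ + β Θ μ = 0 → P Θ = Θ := by
    intro Θ hΘ
    have hZ : Θ.toLinearMap₁₂ ∈ kvZ2 μ.toLinearMap₁₂ := by
      intro a b c
      have h1 := kvPolar_add_eq_neg_kvCoboundary₂ μ Θ a b c
      rw [← hβ, ← hβ, hΘ, zero_apply, zero_apply, zero_apply] at h1
      exact neg_eq_zero.1 h1.symm
    obtain ⟨φ, hφ⟩ := hH hZ
    have h2 : Θ = kvInfinitesimal μ (LinearMap.toContinuousLinearMap (-φ)) := by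
      ext a b
      have h3 := hφ a b
      simp only [kvCoboundary₁, toLinearMap₁₂_apply_apply_apply] at h3
      rw [h3, kvInfinitesimal_apply]
      simp
      abel
    rw [h2, hPd]
  let C := ContinuousLinearMap.id ℝ (F →L[ℝ] F →L[ℝ] F) - P
  have hiso := eventually_eq_zero_of_quadratic_eq_zero β
    ((hβ μ μ).trans (kvPolar_self_eq_zero hμ)) P hP
  -- the derivative of `Ψ` at `0` is `P + (1 - P) = 1`
  let Ψ := fun w => conjBilin (Ring.inverse (1 + θ w)) (1 + θ w) (μ + C w)
  have hΨ : ContDiffAt ℝ ω Ψ 0 := contDiffAt_conjBilin μ θ C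
  have hΨ' : HasFDerivAt Ψ ((ContinuousLinearEquiv.refl ℝ (F →L[ℝ] F →L[ℝ] F) :
      (F →L[ℝ] F →L[ℝ] F) ≃L[ℝ] (F →L[ℝ] F →L[ℝ] F)) :
      (F →L[ℝ] F →L[ℝ] F) →L[ℝ] (F →L[ℝ] F →L[ℝ] F)) 0 := by
    refine (hasFDerivAt_conjBilin μ θ C).congr_fderiv (ContinuousLinearMap.ext fun w => ?_)
    exact add_sub_cancel (P w) w
  have hΨ0 : Ψ 0 = μ := by
    ext a b
    simp [Ψ, conjBilin_apply]
  let ζ := hΨ.localInverse hΨ' (by simp)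
  have hζ : ContDiffAt ℝ ω ζ μ := hΨ0 ▸ hΨ.to_localInverse hΨ' (by simp)
  have hζ0 : ζ μ = 0 := by
    have := hΨ.localInverse_apply_image hΨ' (by simp)
    rwa [hΨ0] at this
  have hright : ∀ᶠ ν in 𝓝 μ, Ψ (ζ ν) = ν := by
    have := (hΨ.hasStrictFDerivAt' hΨ' (by simp)).eventually_right_inverse
    rwa [hΨ0] at this
  have hg : ContDiffAt ℝ ω (fun ν => 1 + θ (ζ ν)) μ :=
    contDiffAt_const.add (θ.contDiff.contDiffAt.comp μ hζ)
  refine ⟨fun ν => 1 + θ (ζ ν), ?_⟩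
  have hunit : ∀ᶠ ν in 𝓝 μ, IsUnit (1 + θ (ζ ν)) := by
    refine hg.continuousAt.eventually (Units.isOpen.mem_nhds ?_)
    simp [hζ0]
  have hC : Tendsto (fun ν => C (ζ ν)) (𝓝 μ) (𝓝 0) := by
    have h1 := C.continuous.continuousAt.comp (f := ζ) hζ.continuousAt
    have h2 : C (ζ μ) = 0 := by rw [hζ0, map_zero]
    rw [← h2]
    exact h1
  filter_upwards [hright, hunit, hC.eventually hiso, hg.eventually (by simp)] with ν hν hu hc hgν
  refine ⟨hgν, hu, fun hKV => ?_⟩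
  have key : ∀ a b, (1 + θ (ζ ν)) (ν a b)
      = (μ + C (ζ ν)) ((1 + θ (ζ ν)) a) ((1 + θ (ζ ν)) b) := by
    intro a b
    have h1 : ν a b = Ψ (ζ ν) a b := by rw [hν]
    exact (congrArg _ h1).trans (DFunLike.congr_fun (Ring.mul_inverse_cancel _ hu) _)
  have hzero : C (ζ ν) = 0 := by
    refine hc ?_ ((hβ _ _).trans (kvPolar_self_eq_zero (hKV.of_isUnit hu key)))
    have : C (ζ ν) = ζ ν - P (ζ ν) := rfl
    rw [this, map_sub, hPP, sub_self]
  rw [hzero, add_zero] at key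
  exact key

end Rigidity

/-! ### Smooth families of linear maps and trivializations -/

section Smooth

variable {d : ℕ} {M : Type*} [TopologicalSpace M] [ChartedSpace (EuclideanSpace ℝ (Fin d)) M]

theorem contMDiffAt_of_forall_clm_apply {E G : Type*} [NormedAddCommGroup E] [NormedSpace ℝ E]
    [FiniteDimensional ℝ E] [NormedAddCommGroup G] [NormedSpace ℝ G] {f : M → E →L[ℝ] G} {x : M}
    (hf : ∀ v, ContMDiffAt (𝓡 d) 𝓘(ℝ, G) ∞ (fun y => f y v) x) :
    ContMDiffAt (𝓡 d) 𝓘(ℝ, E →L[ℝ] G) ∞ f x := by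
  let b := Module.finBasis ℝ E
  have h : f = fun y => ∑ i, ContinuousLinearMap.smulRightL ℝ E G
      (LinearMap.toContinuousLinearMap (b.coord i)) (f y (b i)) := by
    ext y v
    conv_lhs => rw [← b.sum_repr v, map_sum]
    simp
  rw [h]
  exact ContMDiffAt.sum fun i _ =>
    (ContinuousLinearMap.contMDiff _).contMDiffAt.comp x (hf (b i))

variable {F : Type*} [NormedAddCommGroup F] [NormedSpace ℝ F]
  {V : M → Type*} [TopologicalSpace (TotalSpace F V)]
  [∀ x, AddCommGroup (V x)] [∀ x, Module ℝ (V x)]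

/-- The product on the model fibre `F` corresponding to the product `μ y` of the fibre `V y` under
a local trivialization; outside of the base set it is zero. -/
def trivializedMul [FiniteDimensional ℝ F] (μ : ∀ x : M, V x →ₗ[ℝ] V x →ₗ[ℝ] V x) (t : Trivialization F (π F V))
    [t.IsLinear ℝ] (y : M) : F →L[ℝ] F →L[ℝ] F :=
  (((μ y).compl₁₂ (t.symmₗ ℝ y) (t.symmₗ ℝ y)).compr₂
    (t.linearMapAt ℝ y)).toContinuousBilinearMap

theorem trivializedMul_linearEquivAt [FiniteDimensional ℝ F]
    (μ : ∀ x : M, V x →ₗ[ℝ] V x →ₗ[ℝ] V x)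
    (t : Trivialization F (π F V)) [t.IsLinear ℝ] {y : M} (hy : y ∈ t.baseSet) (v w : V y) :
    t.linearEquivAt ℝ y hy (μ y v w)
      = trivializedMul μ t y (t.linearEquivAt ℝ y hy v) (t.linearEquivAt ℝ y hy w) := by
  have h : ∀ v : V y, t.symmₗ ℝ y (t.linearEquivAt ℝ y hy v) = v := fun v => by
    have := t.symmₗ_linearMapAt (R := ℝ) hy v
    rwa [t.linearMapAt_def_of_mem hy] at this
  change _ = t.linearMapAt ℝ y (μ y (t.symmₗ ℝ y _) (t.symmₗ ℝ y _))
  rw [h, h, t.linearMapAt_def_of_mem hy]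
  rfl

theorem trivializedMul_apply [FiniteDimensional ℝ F]
    (μ : ∀ x : M, V x →ₗ[ℝ] V x →ₗ[ℝ] V x)
    (t : Trivialization F (π F V)) [t.IsLinear ℝ] {y : M} (hy : y ∈ t.baseSet) (v w : V y) :
    (t (TotalSpace.mk' F y (μ y v w))).2 = trivializedMul μ t y (t (TotalSpace.mk' F y v)).2
      (t (TotalSpace.mk' F y w)).2 :=
  trivializedMul_linearEquivAt μ t hy v w

variable [∀ x, TopologicalSpace (V x)] [FiberBundle F V] [VectorBundle ℝ F V]

/-- A constant section of a smooth local trivialization coincides near a given point with a global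
smooth section. -/
theorem exists_section_eventually_snd_eq [IsManifold (𝓡 d) ∞ M] [T2Space M]
    [ContMDiffVectorBundle ∞ F V (𝓡 d)] (t : Trivialization F (π F V)) [MemTrivializationAtlas t]
    {x : M} (hx : x ∈ t.baseSet) (v : F) :
    ∃ s : Cₛ^∞⟮𝓡 d; F, V⟯, ∀ᶠ y in 𝓝 x, (t (TotalSpace.mk' F y (s y))).2 = v := by
  obtain ⟨ψ, -, hψ⟩ := (SmoothBumpFunction.nhds_basis_tsupport (I := 𝓡 d) x).mem_iff.1
    (t.open_baseSet.mem_nhds hx)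
  have hσ : ContMDiffOn (𝓡 d) ((𝓡 d).prod 𝓘(ℝ, F)) ∞
      (fun y => TotalSpace.mk' F y (t.symm y v)) t.baseSet := by
    rw [t.contMDiffOn_section_baseSet_iff]
    refine contMDiffOn_const (c := v) |>.congr fun y hy => ?_
    exact congrArg Prod.snd (t.apply_mk_symm hy v)
  refine ⟨⟨_, ContMDiffOn.smul_section_of_tsupport ψ.contMDiff.contMDiffOn t.open_baseSet hψ hσ⟩,
    ?_⟩
  filter_upwards [ψ.eventuallyEq_one, t.open_baseSet.mem_nhds hx] with y hy hyt
  change (t (TotalSpace.mk' F y (ψ y • t.symm y v))).2 = v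
  rw [hy, Pi.one_apply, one_smul]
  exact congrArg Prod.snd (t.apply_mk_symm hyt v)

/-- A smooth local trivialization may be restricted to an open set and composed fibrewise with a
smooth family of invertible linear maps. -/
theorem exists_trivialization_comp [IsManifold (𝓡 d) ∞ M] [FiniteDimensional ℝ F]
    [ContMDiffVectorBundle ∞ F V (𝓡 d)]
    (t : Trivialization F (π F V)) [MemTrivializationAtlas t]
    {U : Set M} (hU : IsOpen U) (hUt : U ⊆ t.baseSet) {G : M → F →L[ℝ] F}
    (hG : ContMDiffOn (𝓡 d) 𝓘(ℝ, F →L[ℝ] F) ∞ G U) (hu : ∀ y ∈ U, IsUnit (G y)) :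
    ∃ e : Trivialization F (π F V), e.baseSet = U ∧ e.IsLinear ℝ ∧
      ContMDiffOn ((𝓡 d).prod 𝓘(ℝ, F)) ((𝓡 d).prod 𝓘(ℝ, F)) ∞ e e.source ∧
      ContMDiffOn ((𝓡 d).prod 𝓘(ℝ, F)) ((𝓡 d).prod 𝓘(ℝ, F)) ∞
        e.toOpenPartialHomeomorph.symm e.target ∧
      ∀ y ∈ U, ∀ v : V y, (e (TotalSpace.mk' F y v)).2 = G y (t (TotalSpace.mk' F y v)).2 := by
  classical
  let φ : M → F ≃L[ℝ] F := fun y =>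
    if h : IsUnit (G y) then ContinuousLinearEquiv.unitsEquiv ℝ F h.unit
    else ContinuousLinearEquiv.refl ℝ F
  have hφG : ∀ y ∈ U, (φ y : F →L[ℝ] F) = G y := by
    intro y hy
    simp only [φ, dif_pos (hu y hy)]
    rfl
  have hφs : ∀ y ∈ U, ((φ y).symm : F →L[ℝ] F) = Ring.inverse (G y) := by
    intro y hy
    simp only [φ, dif_pos (hu y hy)]
    exact (Ring.inverse_unit (hu y hy).unit).symm
  have h1 : ContMDiffOn (𝓡 d) 𝓘(ℝ, F →L[ℝ] F) ∞ (fun y => (φ y : F →L[ℝ] F)) U :=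
    hG.congr hφG
  have h2 : ContMDiffOn (𝓡 d) 𝓘(ℝ, F →L[ℝ] F) ∞ (fun y => ((φ y).symm : F →L[ℝ] F)) U := by
    refine ContMDiffOn.congr (f := fun y => Ring.inverse (G y)) (fun y hy => ?_) hφs
    have h3 : ContDiffAt ℝ ∞ (Ring.inverse : (F →L[ℝ] F) → (F →L[ℝ] F)) (G y) :=
      contDiffAt_ringInverse ℝ (hu y hy).unit
    exact h3.comp_contMDiffWithinAt (hG y hy)
  let ψ := FiberwiseLinear.openPartialHomeomorph φ hU h1.continuousOn h2.continuousOn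
  have hψ : ContMDiffOn ((𝓡 d).prod 𝓘(ℝ, F)) ((𝓡 d).prod 𝓘(ℝ, F)) ∞ ψ ψ.source :=
    contMDiffOn_fst.prodMk
      ((h1.comp contMDiffOn_fst (prod_subset_preimage_fst _ _)).clm_apply contMDiffOn_snd)
  have hψ' : ContMDiffOn ((𝓡 d).prod 𝓘(ℝ, F)) ((𝓡 d).prod 𝓘(ℝ, F)) ∞ ψ.symm ψ.target :=
    contMDiffOn_fst.prodMk
      ((h2.comp contMDiffOn_fst (prod_subset_preimage_fst _ _)).clm_apply contMDiffOn_snd)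
  have hfst : ∀ p ∈ t.source, (t p).1 = p.proj := fun p hp => t.coe_fst hp
  let e : Trivialization F (π F V) :=
    { toOpenPartialHomeomorph := t.toOpenPartialHomeomorph ≫ₕ ψ
      baseSet := U
      open_baseSet := hU
      source_eq := by
        ext p
        rw [OpenPartialHomeomorph.trans_source]
        constructor
        · rintro ⟨hp, hp'⟩
          have h3 : (t p).1 ∈ U := hp'.1
          rwa [hfst p hp] at h3
        · intro hp
          have hpt : p ∈ t.source := t.mem_source.2 (hUt hp)
          refine ⟨hpt, ?_, mem_univ _⟩
          change (t p).1 ∈ U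
          rwa [hfst p hpt]
      target_eq := by
        ext q
        rw [OpenPartialHomeomorph.trans_target]
        constructor
        · exact fun hq => hq.1
        · exact fun hq => ⟨hq, t.mem_target.2 (hUt hq.1)⟩
      proj_toFun := fun p hp => hfst p hp.1 }
  have he : ∀ y ∈ U, ∀ v : V y,
      (e (TotalSpace.mk' F y v)).2 = G y (t (TotalSpace.mk' F y v)).2 := by
    intro y hy v
    have h3 : (e (TotalSpace.mk' F y v)).2
        = φ (t (TotalSpace.mk' F y v)).1 (t (TotalSpace.mk' F y v)).2 := rfl
    rw [h3, hfst _ (t.mem_source.2 (hUt hy)), ← hφG y hy]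
    rfl
  refine ⟨e, rfl, ⟨fun y hy => ⟨fun v w => ?_, fun c v => ?_⟩⟩, ?_, ?_, he⟩
  · change (e (TotalSpace.mk' F y (v + w))).2 =
      (e (TotalSpace.mk' F y v)).2 + (e (TotalSpace.mk' F y w)).2
    rw [he y hy, he y hy, he y hy, ← map_add]
    exact congrArg (G y) ((t.linear ℝ (hUt hy)).map_add v w)
  · change (e (TotalSpace.mk' F y (c • v))).2 = c • (e (TotalSpace.mk' F y v)).2
    rw [he y hy, he y hy, ← map_smul]
    exact congrArg (G y) ((t.linear ℝ (hUt hy)).map_smul c v)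
  · exact hψ.comp (t.contMDiffOn.mono fun p hp => hp.1) fun p hp => hp.2
  · exact t.contMDiffOn_symm.comp (hψ'.mono fun p hp => hp.1) fun p hp => hp.2

end Smooth

/-! ### The fibre products of an algebroid with vanishing anchor -/

namespace NonAsymmetricCourantAlgebroid

variable {d : ℕ} {M : Type*} [TopologicalSpace M] [ChartedSpace (EuclideanSpace ℝ (Fin d)) M]
  [IsManifold (𝓡 d) ∞ M] [T2Space M]
  {F : Type*} [NormedAddCommGroup F] [NormedSpace ℝ F] [FiniteDimensional ℝ F]
  {V : M → Type*} [TopologicalSpace (TotalSpace F V)]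
  [∀ x, AddCommGroup (V x)] [∀ x, Module ℝ (V x)] [∀ x, TopologicalSpace (V x)]
  [FiberBundle F V] [VectorBundle ℝ F V] [ContMDiffVectorBundle ∞ F V (𝓡 d)]
  (A : NonAsymmetricCourantAlgebroid d F V) (hρ : A.anchor = 0)

/-- Since `D = 0`, the associator of sections is symmetric in its first two arguments. -/
theorem isKoszulVinberg_fibreMul (x : M) : IsKoszulVinberg (A.fibreMul hρ x) := by
  intro a b c
  obtain ⟨s, rfl⟩ := exists_section_eq (d := d) (F := F) x a
  obtain ⟨t, rfl⟩ := exists_section_eq (d := d) (F := F) x b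
  obtain ⟨u, rfl⟩ := exists_section_eq (d := d) (F := F) x c
  have h := congrArg (fun r : Cₛ^∞⟮𝓡 d; F, V⟯ => r x) (A.associator_sub s t u)
  simp only [A.D_eq_zero, MetricAlmostAlgebroid.associator, ContMDiffSection.coe_sub,
    Pi.sub_apply, ContMDiffSection.coe_zero, Pi.zero_apply, A.mul_apply hρ] at h
  rw [← h]
  abel

theorem contMDiffAt_trivializedMul (t : Trivialization F (π F V)) [MemTrivializationAtlas t]
    {x : M} (hx : x ∈ t.baseSet) :
    ContMDiffAt (𝓡 d) 𝓘(ℝ, F →L[ℝ] F →L[ℝ] F) ∞ (trivializedMul (A.fibreMul hρ) t) x := by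
  refine contMDiffAt_of_forall_clm_apply fun v => contMDiffAt_of_forall_clm_apply fun w => ?_
  obtain ⟨s, hs⟩ := exists_section_eventually_snd_eq (d := d) t hx v
  obtain ⟨s', hs'⟩ := exists_section_eventually_snd_eq (d := d) t hx w
  have h := (t.contMDiffAt_section_iff hx).1 ((A.mul s s').contMDiff.contMDiffAt (x := x))
  refine h.congr_of_eventuallyEq ?_
  filter_upwards [hs, hs', t.open_baseSet.mem_nhds hx] with y hy hy' hyt
  have h1 := trivializedMul_apply (A.fibreMul hρ) t hyt (s y) (s' y)
  rw [hy, hy', ← A.mul_apply hρ] at h1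
  exact h1.symm

/-- The bundle of algebras is trivial near every point, with the algebra of the fibre at this point
as model. -/
theorem exists_local_isomorphism (hH : ∀ x : M, Subsingleton (KVH2 (A.fibreMul hρ x))) (x : M) :
    ∃ (U : Set M) (G : M → F →L[ℝ] F), IsOpen U ∧ x ∈ U ∧
      U ⊆ (trivializationAt F V x).baseSet ∧
      ContMDiffOn (𝓡 d) 𝓘(ℝ, F →L[ℝ] F) ∞ G U ∧ (∀ y ∈ U, IsUnit (G y)) ∧
      ∀ y ∈ U, ∀ a b,
        G y (trivializedMul (A.fibreMul hρ) (trivializationAt F V x) y a b)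
          = trivializedMul (A.fibreMul hρ) (trivializationAt F V x) x (G y a) (G y b) := by
  set t := trivializationAt F V x
  have hx : x ∈ t.baseSet := FiberBundle.mem_baseSet_trivializationAt' x
  set ν := trivializedMul (A.fibreMul hρ) t
  have hKV : ∀ y ∈ t.baseSet, IsKoszulVinberg (ν y).toLinearMap₁₂ := fun y hy =>
    (A.isKoszulVinberg_fibreMul hρ y).of_linearEquiv (t.linearEquivAt ℝ y hy)
      (trivializedMul_linearEquivAt _ t hy)
  have hZB : kvZ2 (ν x).toLinearMap₁₂ ≤ kvB2 (ν x).toLinearMap₁₂ :=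
    kvZ2_le_kvB2_of_linearEquiv (t.linearEquivAt ℝ x hx) (trivializedMul_linearEquivAt _ t hx)
      (kvZ2_le_kvB2_of_subsingleton (hH x))
  obtain ⟨g, hg⟩ := exists_contDiffAt_isomorphism (hKV x hx) hZB
  have hcont : ContinuousAt ν x := (A.contMDiffAt_trivializedMul hρ t hx).continuousAt
  obtain ⟨U, hU, hUo, hxU⟩ := mem_nhds_iff.1
    ((hcont.eventually hg).and (t.open_baseSet.mem_nhds hx))
  refine ⟨U, fun y => g (ν y), hUo, hxU, fun y hy => (hU hy).2, fun y hy => ?_,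
    fun y hy => (hU hy).1.2.1, fun y hy => (hU hy).1.2.2 (hKV y (hU hy).2)⟩
  have h1 : ContDiffAt ℝ ∞ g (ν y) := (hU hy).1.1.of_le (by simp)
  exact (h1.comp_contMDiffAt (A.contMDiffAt_trivializedMul hρ t (hU hy).2)).contMDiffWithinAt

/-- Over a connected base all the fibres are isomorphic, because nearby ones are. -/
theorem exists_linearEquiv_fibre [ConnectedSpace M]
    (hH : ∀ x : M, Subsingleton (KVH2 (A.fibreMul hρ x))) (x y : M) :
    ∃ L : V x ≃ₗ[ℝ] V y,
      ∀ a b, L (A.fibreMul hρ x a b) = A.fibreMul hρ y (L a) (L b) := by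
  let r : M → M → Prop := fun x y => ∃ L : V x ≃ₗ[ℝ] V y,
    ∀ a b, L (A.fibreMul hρ x a b) = A.fibreMul hρ y (L a) (L b)
  have hsymm : ∀ x y, r x y → r y x := by
    rintro x y ⟨L, hL⟩
    refine ⟨L.symm, fun a b => ?_⟩
    rw [LinearEquiv.symm_apply_eq, hL, L.apply_symm_apply, L.apply_symm_apply]
  have htrans : ∀ x y z, r x y → r y z → r x z := by
    rintro x y z ⟨L, hL⟩ ⟨L', hL'⟩
    exact ⟨L.trans L', fun a b => by simp [hL, hL']⟩
  refine isPreconnected_univ.induction₂ r (fun x _ => ?_) (fun x y z _ _ _ => htrans x y z)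
    (fun x y _ _ => hsymm x y) (mem_univ x) (mem_univ y)
  rw [nhdsWithin_univ]
  obtain ⟨U, G, hUo, hxU, hUt, -, hu, hG⟩ := A.exists_local_isomorphism hρ hH x
  filter_upwards [hUo.mem_nhds hxU] with y hy
  refine hsymm _ _ ?_
  obtain ⟨u, huG⟩ := hu y hy
  set t := trivializationAt F V x
  have hx : x ∈ t.baseSet := FiberBundle.mem_baseSet_trivializationAt' x
  refine ⟨((t.linearEquivAt ℝ y (hUt hy)).trans
    (ContinuousLinearEquiv.unitsEquiv ℝ F u).toLinearEquiv).trans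
      (t.linearEquivAt ℝ x hx).symm, fun a b => ?_⟩
  have hGL : ∀ a, (ContinuousLinearEquiv.unitsEquiv ℝ F u).toLinearEquiv a = G y a := by
    intro a
    rw [← huG]
    rfl
  simp only [LinearEquiv.trans_apply, hGL]
  rw [LinearEquiv.symm_apply_eq, trivializedMul_linearEquivAt _ t hx,
    trivializedMul_linearEquivAt _ t (hUt hy), hG y hy, LinearEquiv.apply_symm_apply,
    LinearEquiv.apply_symm_apply]

end NonAsymmetricCourantAlgebroid

end

theorem theorem7p5 {d : ℕ} {M : Type*} [TopologicalSpace M]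
    [ChartedSpace (EuclideanSpace ℝ (Fin d)) M] [IsManifold (𝓡 d) ∞ M] [T2Space M]
    [ConnectedSpace M]
    {F : Type*} [NormedAddCommGroup F] [NormedSpace ℝ F] [FiniteDimensional ℝ F]
    {V : M → Type*} [TopologicalSpace (TotalSpace F V)]
    [∀ x, AddCommGroup (V x)] [∀ x, Module ℝ (V x)] [∀ x, TopologicalSpace (V x)]
    [FiberBundle F V] [VectorBundle ℝ F V] [ContMDiffVectorBundle ∞ F V (𝓡 d)]
    (A : NonAsymmetricCourantAlgebroid d F V) (hρ : A.anchor = 0)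
    (hH : ∀ x : M, Subsingleton (KVH2 (A.fibreMul hρ x))) :
    IsLocallyTrivialKVBundle d F V (A.fibreMul hρ) := by
  obtain ⟨x₀⟩ : Nonempty M := inferInstance
  let t₀ := trivializationAt F V x₀
  have hx₀ : x₀ ∈ t₀.baseSet := FiberBundle.mem_baseSet_trivializationAt' x₀
  refine ⟨(trivializedMul (A.fibreMul hρ) t₀ x₀).toLinearMap₁₂,
    (A.isKoszulVinberg_fibreMul hρ x₀).of_linearEquiv (t₀.linearEquivAt ℝ x₀ hx₀)
      (trivializedMul_linearEquivAt _ t₀ hx₀), fun x => ?_⟩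
  obtain ⟨U, G, hUo, hxU, hUt, hGs, hu, hG⟩ := A.exists_local_isomorphism hρ hH x
  obtain ⟨L, hL⟩ := A.exists_linearEquiv_fibre hρ hH x x₀
  set t := trivializationAt F V x
  have hx : x ∈ t.baseSet := FiberBundle.mem_baseSet_trivializationAt' x
  -- the isomorphism from the algebra of the fibre at `x` to the one at `x₀`, read on `F`
  let h : F ≃L[ℝ] F := (((t.linearEquivAt ℝ x hx).symm.trans L).trans
    (t₀.linearEquivAt ℝ x₀ hx₀)).toContinuousLinearEquiv
  have hh : ∀ a b, h (trivializedMul (A.fibreMul hρ) t x a b)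
      = trivializedMul (A.fibreMul hρ) t₀ x₀ (h a) (h b) := by
    intro a b
    obtain ⟨a, rfl⟩ := (t.linearEquivAt ℝ x hx).surjective a
    obtain ⟨b, rfl⟩ := (t.linearEquivAt ℝ x hx).surjective b
    have h1 : ∀ v, h (t.linearEquivAt ℝ x hx v) = t₀.linearEquivAt ℝ x₀ hx₀ (L v) := fun v =>
      congrArg (fun w => t₀.linearEquivAt ℝ x₀ hx₀ (L w)) (LinearEquiv.symm_apply_apply _ v)
    rw [← trivializedMul_linearEquivAt _ t hx, h1, h1, h1, hL,
      trivializedMul_linearEquivAt _ t₀ hx₀]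
  obtain ⟨e, heU, hlin, hs, hs', he⟩ := exists_trivialization_comp t hUo hUt
    (G := fun y => (h : F →L[ℝ] F).comp (G y))
    ((contMDiffOn_const (c := (h : F →L[ℝ] F))).clm_comp hGs)
    (fun y hy => ((ContinuousLinearEquiv.unitsEquiv ℝ F).symm h).isUnit.mul (hu y hy))
  refine ⟨e, heU ▸ hxU, hlin, hs, hs', fun y hy v w => ?_⟩
  rw [heU] at hy
  rw [he y hy, he y hy, he y hy, trivializedMul_apply _ t (hUt hy)]
  change h (G y _) = _
  rw [hG y hy, hh]
  rfl
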